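/- Let $C$ be a smooth manifold (finite-dimensional, Hausdorff, second countable, without boundary) with a smooth foliation $\mathcal F$, that is, a smooth involutive subbundle $T\mathcal F\subset TC$ of constant rank. Let $N\mathcal F=TC/T\mathcal F$ be the normal bundle, and write $\bar N\in\Gamma(N\mathcal F)$ for the class of a vector field $N$. Notation. * $\Omega^1(\mathcal F)=\Gamma(T^*\mathcal F)$ is the space of foliated $1$-forms, with foliated differential $(d_{\mathcal F}f)(V)=V(f)$ and $(d_{\mathcal F}\beta)(V,W)=V(\beta(W))-W(\beta(V))-\beta([V,W])$ for $f\in C^\infty(C)$, $\beta\in\Omega^1(\mathcal F)$ and $V,W\in\Gamma(T\mathcal F)$; $H^1(\mathcal F)=\{\beta\in\Omega^1(\mathcal F): d_{\mathcal F}\beta=0\}/d_{\mathcal F}C^\infty(C)$. An extension of $\beta\in\Omega^1(\mathcal F)$ is a $1$-form $\tilde\beta\in\Omega^1(C)$ whose restriction to $T\mathcal F$ is $\beta$. * The Bott connection is $\nabla_V\bar N=\overline{[V,N]}$ on $N\mathcal F$, with dual connection $\langle\nabla^*_V\gamma,\bar N\rangle=V\langle\gamma,\bar N\rangle-\langle\gamma,\nabla_V\bar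 N\rangle$ on $N^*\mathcal F$, for $V\in\Gamma(T\mathcal F)$. It induces the differential $d_{\nabla^*}$ on $\Omega^\bullet(\mathcal F;N^*\mathcal F)$, given by $(d_{\nabla^*}\gamma)(V)=\nabla^*_V\gamma$ on $\Gamma(N^*\mathcal F)$ and $(d_{\nabla^*}\eta)(V,W)=\nabla^*_V(\eta(W))-\nabla^*_W(\eta(V))-\eta([V,W])$ on $\Omega^1(\mathcal F;N^*\mathcal F)$; $H^1(\mathcal F;N^*\mathcal F)$ is its first cohomology. * If $\theta\in\Omega^2(C)$ vanishes on pairs of vectors tangent to $\mathcal F$, let $p(\theta)\in\Omega^1(\mathcal F;N^*\mathcal F)$ be given by $\langle p(\theta)(V),\bar N\rangle=\theta(V,N)$. The transverse differentiation map is $$d_\nu: H^1(\mathcal F)\to H^1(\mathcal F;N^*\mathcal F),\qquad [\alpha]\mapsto[p(d\tilde\alpha)],$$ where $\tilde\alpha\in\Omega^1(C)$ is any extension of $\alpha$. * A form $\theta\in\Omega^2(C)$ is basic if $\iota_V\theta=0$ and $\mathcal L_V\theta=0$ for all $V\in\Gamma(T\mathcal F)$. Claim. For every $\beta\in\Omega^1(\mathcal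 F)$ the following are equivalent: 1. $d_{\mathcal F}\beta=0$ and $d_\nu[\beta]=0$ in $H^1(\mathcal F;N^*\mathcal F)$; 2. there is an extension $\tilde\beta\in\Omega^1(C)$ of $\beta$ such that $\iota_V d\tilde\beta=0$ for all $V\in\Gamma(T\mathcal F)$. Moreover, for every $\tilde\beta\in\Omega^1(C)$, one has $\iota_V d\tilde\beta=0$ for all $V\in\Gamma(T\mathcal F)$ if and only if $d\tilde\beta$ is basic; so statement (2) says that $\beta$ has an extension $\tilde\beta$ with $d\tilde\beta$ basic. -/

import Mathlib

open Bundle VectorField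
open scoped Manifold ContDiff Topology

noncomputable section
namespace Foliated

section Basics
variable (E : Type*) [NormedAddCommGroup E] [NormedSpace ℝ E]
  (C : Type*) [TopologicalSpace C] [ChartedSpace E C] [IsManifold 𝓘(ℝ, E) ∞ C]

/-- Smooth real functions on `C`. -/
abbrev SmoothFn : Type _ := C^∞⟮𝓘(ℝ, E), C; ℝ⟯

/-- Smooth vector fields on `C`, that is smooth sections of the tangent bundle. -/
abbrev VField : Type _ := Cₛ^∞⟮𝓘(ℝ, E); E, (TangentSpace 𝓘(ℝ, E) : C → Type _)⟯

/-- Smooth 1-forms on `C`, that is smooth sections of the cotangent bundle. -/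
abbrev OneForm : Type _ :=
  Cₛ^∞⟮𝓘(ℝ, E); E →L[ℝ] ℝ, fun x : C ↦ TangentSpace 𝓘(ℝ, E) x →L[ℝ] ℝ⟯

variable {E C}

/-- The derivative `V f` of a function along a vector field. -/
def VField.deriv (V : VField E C) (f : SmoothFn E C) : SmoothFn E C :=
  ⟨fun x ↦ mvfderiv 𝓘(ℝ, E) f x (V x), by
    have h1 : ContMDiff 𝓘(ℝ, E).tangent 𝓘(ℝ, ℝ).tangent ∞ (tangentMap 𝓘(ℝ, E) 𝓘(ℝ, ℝ) f) :=
      f.contMDiff.contMDiff_tangentMap (by simp)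
    exact (contMDiff_snd_tangentBundle_modelSpace ℝ 𝓘(ℝ, ℝ)).comp (h1.comp V.contMDiff)⟩

theorem VField.deriv_apply (V : VField E C) (f : SmoothFn E C) (x : C) :
    V.deriv f x = mvfderiv 𝓘(ℝ, E) f x (V x) := rfl

/-- The function `a(V)`. -/
def OneForm.eval (a : OneForm E C) (V : VField E C) : SmoothFn E C :=
  ⟨fun x ↦ a x (V x), fun x => by
    have := (a.contMDiff x).clm_bundle_apply (F₂ := ℝ) (E₂ := Bundle.Trivial C ℝ) (V.contMDiff x)
    exact ((contMDiffAt_section (E := Bundle.Trivial C ℝ) x).1 this)⟩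

/-- The vector field `f V`. -/
def fsmul (f : SmoothFn E C) (V : VField E C) : VField E C :=
  ⟨fun x ↦ f x • V x, f.contMDiff.smul_section V.contMDiff⟩

theorem SmoothFn.mdiffAt (f : SmoothFn E C) (x : C) : MDifferentiableAt 𝓘(ℝ, E) 𝓘(ℝ, ℝ) f x :=
  f.contMDiff.mdifferentiable (by simp) x

theorem deriv_add (V : VField E C) (f g : SmoothFn E C) :
    V.deriv (f + g) = V.deriv f + V.deriv g := by
  ext x
  have := mvfderiv_add (SmoothFn.mdiffAt f x) (SmoothFn.mdiffAt g x)
  exact congrArg (fun L => L (V x)) this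

theorem deriv_smul (V : VField E C) (c : ℝ) (f : SmoothFn E C) :
    V.deriv (c • f) = c • V.deriv f := by
  ext x
  have := mvfderiv_smul (a := fun _ : C => c) (I := 𝓘(ℝ, E)) mdifferentiableAt_const (SmoothFn.mdiffAt f x)
  have := congrArg (fun L => L (V x)) this
  simp [mvfderiv_const] at this
  exact this

theorem deriv_sub (V : VField E C) (f g : SmoothFn E C) :
    V.deriv (f - g) = V.deriv f - V.deriv g := by
  ext x
  have := mvfderiv_sub (SmoothFn.mdiffAt f x) (SmoothFn.mdiffAt g x)
  exact congrArg (fun L => L (V x)) this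

section Global
variable [FiniteDimensional ℝ E] [T2Space C]

theorem exists_global {x₀ : C} {U : Set C} (hU : IsOpen U) (hx : x₀ ∈ U)
    (s : ∀ x : C, TangentSpace 𝓘(ℝ, E) x)
    (hs : ContMDiffOn 𝓘(ℝ, E) (𝓘(ℝ, E).prod 𝓘(ℝ, E)) ∞ (fun x ↦ (s x : TangentBundle 𝓘(ℝ, E) C)) U) :
    ∃ S : VField E C, (∀ᶠ x in 𝓝 x₀, S x = s x) ∧
      ∀ x, ∃ c : ℝ, S x = c • s x ∧ (x ∉ U → c = 0) := by
  obtain ⟨f, -, hf⟩ := ((SmoothBumpFunction.nhds_basis_tsupport (I := 𝓘(ℝ, E)) x₀).mem_iff).1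
    (hU.mem_nhds hx)
  refine ⟨⟨fun x ↦ f x • s x, ContMDiffOn.smul_section_of_tsupport (f.contMDiff.contMDiffOn) hU hf hs⟩,
    ?_, fun x ↦ ⟨f x, rfl, fun hxU ↦ ?_⟩⟩
  · filter_upwards [f.eventuallyEq_one] with x hx
    simp [hx]
  · exact image_eq_zero_of_notMem_tsupport fun h => hxU (hf h)

theorem exists_vfield (x₀ : C) (v : TangentSpace 𝓘(ℝ, E) x₀) : ∃ S : VField E C, S x₀ = v := by
  let e := trivializationAt E (TangentSpace 𝓘(ℝ, E) : C → Type _) x₀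
  have hx : x₀ ∈ e.baseSet := FiberBundle.mem_baseSet_trivializationAt E _ x₀
  obtain ⟨S, hS, -⟩ := exists_global (E := E) e.open_baseSet hx
    (fun x ↦ e.symm x (e ⟨x₀, v⟩).2) (by
      rw [e.contMDiffOn_section_baseSet_iff]
      refine (contMDiffOn_const (c := (e ⟨x₀, v⟩).2)).congr fun x hx => ?_
      rw [e.apply_mk_symm hx])
  refine ⟨S, ?_⟩
  rw [hS.self_of_nhds]
  exact e.symm_apply_apply_mk hx v
end Global

variable [FiniteDimensional ℝ E]

theorem isManifold_min (n : ℕ) [n.AtLeastTwo] : IsManifold 𝓘(ℝ, E) (minSmoothness ℝ (OfNat.ofNat n)) C := by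
  rw [minSmoothness_of_isRCLikeNormedField]; infer_instance

/-- The Lie bracket `[V, W]` of vector fields. -/
def lie (V W : VField E C) : VField E C :=
  ⟨mlieBracket 𝓘(ℝ, E) V W, fun x => by
    have : CompleteSpace E := FiniteDimensional.complete ℝ E
    have := isManifold_min (E := E) (C := C) 2
    have : IsManifold 𝓘(ℝ, E) (((⊤ : ℕ∞) : WithTop ℕ∞) + 1) C := ‹IsManifold 𝓘(ℝ, E) ∞ C›
    exact ContMDiffAt.mlieBracket_vectorField (m := ⊤) (n := ⊤) (V.contMDiff x) (W.contMDiff x)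
      (by simp)⟩

theorem jacobi (U V W : VField E C) : lie U (lie V W) = lie (lie U V) W + lie V (lie U W) := by
  have : CompleteSpace E := FiniteDimensional.complete ℝ E
  have := isManifold_min (E := E) (C := C) 3
  have h2 : (minSmoothness ℝ 2) ≤ (∞ : WithTop ℕ∞) := by
    rw [minSmoothness_of_isRCLikeNormedField]; exact WithTop.coe_le_coe.2 le_top
  ext x
  exact leibniz_identity_mlieBracket_apply ((U.contMDiff x).of_le h2) ((V.contMDiff x).of_le h2)
    ((W.contMDiff x).of_le h2)

theorem lie_fsmul (V W : VField E C) (f : SmoothFn E C) :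
    lie V (fsmul f W) = fsmul (V.deriv f) W + fsmul f (lie V W) := by
  have : CompleteSpace E := FiniteDimensional.complete ℝ E
  ext x
  exact mlieBracket_smul_right (SmoothFn.mdiffAt f x) W.mdifferentiableAt

theorem lie_add (V W W' : VField E C) : lie V (W + W') = lie V W + lie V W' := by
  have : CompleteSpace E := FiniteDimensional.complete ℝ E
  ext x
  exact mlieBracket_add_right W.mdifferentiableAt W'.mdifferentiableAt

theorem deriv_lie [T2Space C] (U V : VField E C) (f : SmoothFn E C) :
    (lie U V).deriv f = U.deriv (V.deriv f) - V.deriv (U.deriv f) := by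
  ext x
  rcases subsingleton_or_nontrivial E with hE | hE
  · have h : ∀ v : TangentSpace 𝓘(ℝ, E) x, v = 0 := fun v => @Subsingleton.elim E hE v 0
    have h' : ∀ (X : VField E C) (g : SmoothFn E C), X.deriv g x = 0 := fun X g => by
      rw [VField.deriv_apply, h (X x), map_zero]
    rw [ContMDiffMap.coe_sub, Pi.sub_apply, h', h', h', sub_zero]
  obtain ⟨v, hv⟩ := exists_ne (0 : E)
  obtain ⟨W, hW⟩ := exists_vfield (E := E) x v
  have h := jacobi U V (fsmul f W)
  simp only [lie_fsmul, lie_add] at h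
  rw [jacobi U V W] at h
  have hx := DFunLike.congr_fun h x
  have key : ((lie U V).deriv f x) • W x = (U.deriv (V.deriv f) x - V.deriv (U.deriv f) x) • W x := by
    simp only [fsmul, ContMDiffSection.coe_add, Pi.add_apply, ContMDiffSection.coeFn_mk, smul_add] at hx
    rw [sub_smul]
    have := sub_eq_zero.2 hx
    rw [← sub_eq_zero, ← neg_eq_zero, ← this]
    abel
  rw [hW] at key
  exact smul_left_injective ℝ hv key


variable (E C) in
/-- Families of bilinear forms on the tangent spaces, without any smoothness. -/
def PreTwoForm : Type _ := ∀ x : C, TangentSpace 𝓘(ℝ, E) x →ₗ[ℝ] TangentSpace 𝓘(ℝ, E) x →ₗ[ℝ] ℝ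

instance : AddCommGroup (PreTwoForm E C) := inferInstanceAs
  (AddCommGroup (∀ x : C, TangentSpace 𝓘(ℝ, E) x →ₗ[ℝ] TangentSpace 𝓘(ℝ, E) x →ₗ[ℝ] ℝ))

instance : Module ℝ (PreTwoForm E C) := inferInstanceAs
  (Module ℝ (∀ x : C, TangentSpace 𝓘(ℝ, E) x →ₗ[ℝ] TangentSpace 𝓘(ℝ, E) x →ₗ[ℝ] ℝ))

variable (E C) in
/-- Smooth 2-forms on `C`: pointwise alternating bilinear forms whose values on smooth vector fields
are smooth functions. -/
def TwoForm : Submodule ℝ (PreTwoForm E C) where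
  carrier := {θ | (∀ x v, θ x v v = 0) ∧
    ∀ V W : VField E C, ContMDiff 𝓘(ℝ, E) 𝓘(ℝ, ℝ) ∞ fun x ↦ θ x (V x) (W x)}
  add_mem' := fun h h' ↦
    ⟨fun x v ↦ (congrArg₂ (· + ·) (h.1 x v) (h'.1 x v)).trans (add_zero 0),
      fun V W ↦ (h.2 V W).add (h'.2 V W)⟩
  zero_mem' := ⟨fun _ _ ↦ rfl, fun _ _ ↦ contMDiff_const⟩
  smul_mem' := fun c _ h ↦ ⟨fun x v ↦ (congrArg (c * ·) (h.1 x v)).trans (mul_zero c),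
    fun V W ↦ (contMDiff_const (I := 𝓘(ℝ, E)) (I' := 𝓘(ℝ, ℝ)) (c := c)).smul (h.2 V W)⟩

theorem mem_twoForm {θ : PreTwoForm E C} : θ ∈ TwoForm E C ↔ (∀ x v, θ x v v = 0) ∧
    ∀ V W : VField E C, ContMDiff 𝓘(ℝ, E) 𝓘(ℝ, ℝ) ∞ fun x ↦ θ x (V x) (W x) := Iff.rfl

/-- The Koszul expression `V(a(W)) - W(a(V)) - a([V, W])`. -/
def koszul (a : OneForm E C) (V W : ∀ x : C, TangentSpace 𝓘(ℝ, E) x) (x : C) : ℝ :=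
  mvfderiv 𝓘(ℝ, E) (fun y ↦ a y (W y)) x (V x) - mvfderiv 𝓘(ℝ, E) (fun y ↦ a y (V y)) x (W x) -
    a x (mlieBracket 𝓘(ℝ, E) V W x)

theorem OneForm.mdiff (a : OneForm E C) {V : ∀ x : C, TangentSpace 𝓘(ℝ, E) x} {x : C}
    (hV : MDifferentiableAt 𝓘(ℝ, E) (𝓘(ℝ, E).prod 𝓘(ℝ, E))
      (fun x ↦ (V x : TangentBundle 𝓘(ℝ, E) C)) x) :
    MDifferentiableAt 𝓘(ℝ, E) 𝓘(ℝ, ℝ) (fun y ↦ a y (V y)) x := by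
  have := (a.mdifferentiableAt (x := x)).clm_bundle_apply (F₂ := ℝ) (E₂ := Bundle.Trivial C ℝ) hV
  exact (mdifferentiableAt_section (E := Bundle.Trivial C ℝ) _ _).1 this

theorem koszul_tensorial₂ (a : OneForm E C) (V : ∀ x : C, TangentSpace 𝓘(ℝ, E) x) (x : C) :
    TensorialAt 𝓘(ℝ, E) E (fun W : ∀ x : C, TangentSpace 𝓘(ℝ, E) x ↦ koszul a V W x) x where
  smul {f W} hf hW := by
    have : CompleteSpace E := FiniteDimensional.complete ℝ E
    have h1 := mvfderiv_mul (I := 𝓘(ℝ, E)) hf (OneForm.mdiff a hW)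
    have h2 : (fun y ↦ a y ((f • W) y)) = f * fun y ↦ a y (W y) := by
      ext y; simp
    simp only [koszul, h2, h1, mlieBracket_smul_right hf hW]
    simp
    ring
  add {W W'} hW hW' := by
    have : CompleteSpace E := FiniteDimensional.complete ℝ E
    have h1 := mvfderiv_add (I := 𝓘(ℝ, E)) (OneForm.mdiff a hW) (OneForm.mdiff a hW')
    have h2 : (fun y ↦ a y ((W + W') y)) = (fun y ↦ a y (W y)) + fun y ↦ a y (W' y) := by
      ext y; simp
    simp only [koszul, h2, h1, mlieBracket_add_right hW hW']
    simp
    ring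

theorem koszul_swap (a : OneForm E C) (V W : ∀ x : C, TangentSpace 𝓘(ℝ, E) x) (x : C) :
    koszul a V W x = - koszul a W V x := by
  simp only [koszul, mlieBracket_swap_apply (V := V) (W := W), map_neg]; ring

theorem koszul_tensorial₁ (a : OneForm E C) (W : ∀ x : C, TangentSpace 𝓘(ℝ, E) x) (x : C) :
    TensorialAt 𝓘(ℝ, E) E (fun V : ∀ x : C, TangentSpace 𝓘(ℝ, E) x ↦ koszul a V W x) x where
  smul {f V} hf hV := by
    simp only [koszul_swap a _ W, (koszul_tensorial₂ a W x).smul hf hV, smul_neg]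
  add {V V'} hV hV' := by
    simp only [koszul_swap a _ W, (koszul_tensorial₂ a W x).add hV hV', neg_add]

/-- The Koszul expression is tensorial in both fields, hence is given by a bilinear form on each
tangent space. -/
def koszulAt (a : OneForm E C) (x : C) :
    TangentSpace 𝓘(ℝ, E) x →L[ℝ] TangentSpace 𝓘(ℝ, E) x →L[ℝ] ℝ :=
  TensorialAt.mkHom₂ (fun V W ↦ koszul a V W x) x (fun W _ ↦ koszul_tensorial₁ a W x)
    (fun V _ ↦ koszul_tensorial₂ a V x)

theorem koszulAt_apply (a : OneForm E C) (V W : VField E C) (x : C) :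
    koszulAt a x (V x) (W x) = (V.deriv (a.eval W) - W.deriv (a.eval V) - a.eval (lie V W)) x :=
  TensorialAt.mkHom₂_apply (I := 𝓘(ℝ, E)) _ _ V.mdifferentiableAt W.mdifferentiableAt

theorem eval_add (a b : OneForm E C) (V : VField E C) :
    (a + b).eval V = a.eval V + b.eval V := rfl

theorem eval_smul (c : ℝ) (a : OneForm E C) (V : VField E C) :
    (c • a).eval V = c • a.eval V := rfl

variable [T2Space C]

theorem koszulAt_self (a : OneForm E C) (x : C) (v : TangentSpace 𝓘(ℝ, E) x) :
    koszulAt a x v v = 0 := by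
  obtain ⟨V, rfl⟩ := exists_vfield (E := E) x v
  have := koszul_swap a V V x
  have h2 : koszulAt a x (V x) (V x) = koszul a V V x :=
    TensorialAt.mkHom₂_apply (I := 𝓘(ℝ, E)) _ _ V.mdifferentiableAt V.mdifferentiableAt
  linarith

theorem koszulAt_add (a b : OneForm E C) (x : C) (v w : TangentSpace 𝓘(ℝ, E) x) :
    koszulAt (a + b) x v w = koszulAt a x v w + koszulAt b x v w := by
  obtain ⟨V, rfl⟩ := exists_vfield (E := E) x v
  obtain ⟨W, rfl⟩ := exists_vfield (E := E) x w
  simp only [koszulAt_apply, eval_add, deriv_add, ContMDiffMap.coe_add, ContMDiffMap.coe_sub,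
    Pi.add_apply, Pi.sub_apply]
  ring

theorem koszulAt_smul (c : ℝ) (a : OneForm E C) (x : C) (v w : TangentSpace 𝓘(ℝ, E) x) :
    koszulAt (c • a) x v w = c * koszulAt a x v w := by
  obtain ⟨V, rfl⟩ := exists_vfield (E := E) x v
  obtain ⟨W, rfl⟩ := exists_vfield (E := E) x w
  simp only [koszulAt_apply, eval_smul, deriv_smul, ContMDiffMap.coe_smul, ContMDiffMap.coe_sub,
    Pi.smul_apply, Pi.sub_apply, smul_eq_mul]
  ring

/-- The exterior derivative `d : Ω¹(C) → Ω²(C)`, characterised by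
`(da)(V, W) = V(a(W)) - W(a(V)) - a([V, W])` (see `extDerivOne_apply`). -/
def extDerivOne : OneForm E C →ₗ[ℝ] TwoForm E C where
  toFun a := ⟨fun x ↦ ContinuousLinearMap.coeLM ℝ ∘ₗ (koszulAt a x).toLinearMap,
    koszulAt_self a, fun V W ↦
      (V.deriv (a.eval W) - W.deriv (a.eval V) - a.eval (lie V W)).contMDiff.congr
        fun x ↦ koszulAt_apply a V W x⟩
  map_add' a b := Subtype.ext <| funext fun x ↦ LinearMap.ext fun v ↦ LinearMap.ext fun w ↦
    koszulAt_add a b x v w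
  map_smul' c a := Subtype.ext <| funext fun x ↦ LinearMap.ext fun v ↦ LinearMap.ext fun w ↦
    koszulAt_smul c a x v w

theorem extDerivOne_apply (a : OneForm E C) (V W : VField E C) (x : C) :
    (extDerivOne a).1 x (V x) (W x) = (V.deriv (a.eval W) - W.deriv (a.eval V) - a.eval (lie V W)) x :=
  koszulAt_apply a V W x

/-- The function `θ(X, Y)`. -/
def evalTwo (θ : TwoForm E C) (X Y : VField E C) : SmoothFn E C :=
  ⟨fun x ↦ θ.1 x (X x) (Y x), (mem_twoForm.1 θ.2).2 X Y⟩

/-- The interior product `ι_V θ`, as a family of linear forms on the tangent spaces. -/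
def interior (V : VField E C) (θ : TwoForm E C) : ∀ x : C, TangentSpace 𝓘(ℝ, E) x →ₗ[ℝ] ℝ :=
  fun x ↦ θ.1 x (V x)

/-- The Lie derivative `£_V θ`, through its values on vector fields:
`(£_V θ)(X, Y) = V(θ(X, Y)) - θ([V, X], Y) - θ(X, [V, Y])`. -/
def lieDeriv (V : VField E C) (θ : TwoForm E C) (X Y : VField E C) : SmoothFn E C :=
  V.deriv (evalTwo θ X Y) - evalTwo θ (lie V X) Y - evalTwo θ X (lie V Y)

end Basics

section Fol
variable (E : Type*) [NormedAddCommGroup E] [NormedSpace ℝ E]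
  (C : Type*) [TopologicalSpace C] [ChartedSpace E C] [IsManifold 𝓘(ℝ, E) ∞ C]

/-- A smooth foliation of `C`, given by its tangent distribution `TF`: a smooth subbundle of `TC` of
constant rank which is involutive. -/
structure Foliation where
  /-- The dimension of the leaves. -/
  rank : ℕ
  /-- The tangent space `T_xF` of the leaf through `x`. -/
  tangent : ∀ x : C, Submodule ℝ (TangentSpace 𝓘(ℝ, E) x)
  /-- `TF` is locally spanned by a smooth frame. -/
  exists_frame : ∀ x₀ : C, ∃ U : Set C, IsOpen U ∧ x₀ ∈ U ∧
    ∃ s : Fin rank → ∀ x : C, TangentSpace 𝓘(ℝ, E) x,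
      (∀ i, ContMDiffOn 𝓘(ℝ, E) (𝓘(ℝ, E).prod 𝓘(ℝ, E)) ∞
        (fun x ↦ (s i x : TangentBundle 𝓘(ℝ, E) C)) U) ∧
      ∀ x ∈ U, LinearIndependent ℝ (fun i ↦ s i x) ∧
        Submodule.span ℝ (Set.range fun i ↦ s i x) = tangent x
  /-- `Γ(TF)` is closed under the Lie bracket. -/
  involutive : ∀ V W : VField E C, (∀ x, V x ∈ tangent x) → (∀ x, W x ∈ tangent x) →
    ∀ x, mlieBracket 𝓘(ℝ, E) V W x ∈ tangent x

variable {E C}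
namespace Foliation
variable (F : Foliation E C)

/-- `Γ(TF)`: the vector fields tangent to the foliation. -/
def sections : Submodule ℝ (VField E C) where
  carrier := {V | ∀ x, V x ∈ F.tangent x}
  add_mem' h h' x := (F.tangent x).add_mem (h x) (h' x)
  zero_mem' x := (F.tangent x).zero_mem
  smul_mem' c _ h x := (F.tangent x).smul_mem c (h x)

/-- Families of linear forms on the spaces `T_xF`. -/
def PreFoliatedOneForm : Type _ := ∀ x : C, F.tangent x →ₗ[ℝ] ℝ

instance : AddCommGroup F.PreFoliatedOneForm := inferInstanceAs
  (AddCommGroup (∀ x : C, F.tangent x →ₗ[ℝ] ℝ))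

instance : Module ℝ F.PreFoliatedOneForm := inferInstanceAs
  (Module ℝ (∀ x : C, F.tangent x →ₗ[ℝ] ℝ))

/-- Foliated 1-forms `Ω¹(F) = Γ(T*F)`: families of linear forms on `TF` which are smooth, that is,
take smooth sections of `TF` to smooth functions. -/
def FoliatedOneForm : Submodule ℝ F.PreFoliatedOneForm where
  carrier := {β | ∀ V : F.sections,
    ContMDiff 𝓘(ℝ, E) 𝓘(ℝ, ℝ) ∞ fun x ↦ β x ⟨V.1 x, V.2 x⟩}
  add_mem' h h' V := (h V).add (h' V)
  zero_mem' _ := contMDiff_const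
  smul_mem' c _ h V := (contMDiff_const (I := 𝓘(ℝ, E)) (I' := 𝓘(ℝ, ℝ)) (c := c)).smul (h V)

/-- Families of linear forms on the normal spaces `N_xF = T_xC / T_xF`. -/
def PreConormalSection : Type _ := ∀ x : C, (TangentSpace 𝓘(ℝ, E) x ⧸ F.tangent x) →ₗ[ℝ] ℝ

instance : AddCommGroup F.PreConormalSection := inferInstanceAs
  (AddCommGroup (∀ x : C, (TangentSpace 𝓘(ℝ, E) x ⧸ F.tangent x) →ₗ[ℝ] ℝ))

instance : Module ℝ F.PreConormalSection := inferInstanceAs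
  (Module ℝ (∀ x : C, (TangentSpace 𝓘(ℝ, E) x ⧸ F.tangent x) →ₗ[ℝ] ℝ))

/-- `Ω⁰(F; N*F) = Γ(N*F)`, the smooth sections of the dual of the normal bundle `NF = TC / TF`.
Smooth sections of `NF` are the classes of smooth vector fields, so smoothness is tested on these. -/
def ConormalSection : Submodule ℝ F.PreConormalSection where
  carrier := {γ | ∀ N : VField E C,
    ContMDiff 𝓘(ℝ, E) 𝓘(ℝ, ℝ) ∞ fun x ↦ γ x ((F.tangent x).mkQ (N x))}
  add_mem' h h' V := (h V).add (h' V)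
  zero_mem' _ := contMDiff_const
  smul_mem' c _ h V := (contMDiff_const (I := 𝓘(ℝ, E)) (I' := 𝓘(ℝ, ℝ)) (c := c)).smul (h V)

/-- Families of linear maps `T_xF → N*_xF`. -/
def PreConormalOneForm : Type _ :=
  ∀ x : C, F.tangent x →ₗ[ℝ] (TangentSpace 𝓘(ℝ, E) x ⧸ F.tangent x) →ₗ[ℝ] ℝ

instance : AddCommGroup F.PreConormalOneForm := inferInstanceAs
  (AddCommGroup (∀ x : C, F.tangent x →ₗ[ℝ] (TangentSpace 𝓘(ℝ, E) x ⧸ F.tangent x) →ₗ[ℝ] ℝ))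

instance : Module ℝ F.PreConormalOneForm := inferInstanceAs
  (Module ℝ (∀ x : C, F.tangent x →ₗ[ℝ] (TangentSpace 𝓘(ℝ, E) x ⧸ F.tangent x) →ₗ[ℝ] ℝ))

/-- `Ω¹(F; N*F)`: the smooth foliated 1-forms with values in `N*F`. -/
def ConormalOneForm : Submodule ℝ F.PreConormalOneForm where
  carrier := {η | ∀ (V : F.sections) (N : VField E C),
    ContMDiff 𝓘(ℝ, E) 𝓘(ℝ, ℝ) ∞ fun x ↦ η x ⟨V.1 x, V.2 x⟩ ((F.tangent x).mkQ (N x))}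
  add_mem' h h' V N := (h V N).add (h' V N)
  zero_mem' _ _ := contMDiff_const
  smul_mem' c _ h V N := (contMDiff_const (I := 𝓘(ℝ, E)) (I' := 𝓘(ℝ, ℝ)) (c := c)).smul (h V N)

variable {F}

/-- The function `β(V)`. -/
def evalF (β : F.FoliatedOneForm) (V : F.sections) : SmoothFn E C :=
  ⟨fun x ↦ β.1 x ⟨V.1 x, V.2 x⟩, β.2 V⟩

/-- The pairing `⟨γ, N̄⟩` with the class `N̄` of a vector field in `Γ(NF)`. -/
def evalN (γ : F.ConormalSection) (N : VField E C) : SmoothFn E C :=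
  ⟨fun x ↦ γ.1 x ((F.tangent x).mkQ (N x)), γ.2 N⟩

/-- The section `η(V)` of `N*F`. -/
def contract (η : F.ConormalOneForm) (V : F.sections) : F.ConormalSection :=
  ⟨fun x ↦ η.1 x ⟨V.1 x, V.2 x⟩, η.2 V⟩

variable (F)

/-- The foliated differential on functions, `(d_F f)(V) = V f`. -/
def dF₀ : SmoothFn E C →ₗ[ℝ] F.FoliatedOneForm where
  toFun f := ⟨fun x ↦ (mvfderiv 𝓘(ℝ, E) f x).toLinearMap ∘ₗ (F.tangent x).subtype,
    fun V ↦ (V.1.deriv f).contMDiff⟩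
  map_add' f g := Subtype.ext <| funext fun x ↦ LinearMap.ext fun v ↦
    congrArg (fun L ↦ L v.1)
      (mvfderiv_add (I := 𝓘(ℝ, E)) (SmoothFn.mdiffAt f x) (SmoothFn.mdiffAt g x))
  map_smul' c f := Subtype.ext <| funext fun x ↦ LinearMap.ext fun v ↦ by
    have := congrArg (fun L ↦ L v.1) (mvfderiv_smul (a := fun _ : C ↦ c) (I := 𝓘(ℝ, E))
      mdifferentiableAt_const (SmoothFn.mdiffAt f x))
    simp [mvfderiv_const] at this
    exact this

/-- Restriction of a 1-form to `TF`; `a` is an extension of `β` when `F.restrict a = β`. -/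
def restrict : OneForm E C →ₗ[ℝ] F.FoliatedOneForm where
  toFun a := ⟨fun x ↦ (a x).toLinearMap ∘ₗ (F.tangent x).subtype, fun V ↦ (a.eval V.1).contMDiff⟩
  map_add' _ _ := rfl
  map_smul' _ _ := rfl

variable [FiniteDimensional ℝ E]

variable {F} in
/-- The Lie bracket on `Γ(TF)`. -/
def lieΓ (V W : F.sections) : F.sections :=
  ⟨lie V.1 W.1, F.involutive V.1 W.1 V.2 W.2⟩

/-- The foliated differential on 1-forms, through its values on sections of `TF`:
`(d_F β)(V, W) = V(β(W)) - W(β(V)) - β([V, W])`. -/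
def dF₁ : F.FoliatedOneForm →ₗ[ℝ] (F.sections → F.sections → SmoothFn E C) where
  toFun β V W := V.1.deriv (evalF β W) - W.1.deriv (evalF β V) - evalF β (lieΓ V W)
  map_add' β β' := by
    funext V W
    have h : ∀ X, evalF (β + β') X = evalF β X + evalF β' X := fun _ ↦ rfl
    simp only [h, deriv_add, Pi.add_apply]
    abel
  map_smul' c β := by
    funext V W
    have h : ∀ X, evalF (c • β) X = c • evalF β X := fun _ ↦ rfl
    simp only [h, deriv_smul, Pi.smul_apply, RingHom.id_apply, smul_sub]

/-- The `d_F`-closed foliated 1-forms. -/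
def Cocycles : Submodule ℝ F.FoliatedOneForm := LinearMap.ker F.dF₁

/-- The `d_F`-exact foliated 1-forms. -/
def Coboundaries : Submodule ℝ F.FoliatedOneForm := LinearMap.range F.dF₀

/-- The foliated cohomology `H¹(F)`. -/
abbrev H1 : Type _ := F.Cocycles ⧸ F.Coboundaries.submoduleOf F.Cocycles

/-- The class `[β]` in `H¹(F)` of a closed foliated 1-form. -/
def cohomologyClass (β : F.FoliatedOneForm) (h : F.dF₁ β = 0) : F.H1 :=
  (F.Coboundaries.submoduleOf F.Cocycles).mkQ ⟨β, h⟩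

variable {F} in
/-- The connection `∇*` on `N*F` dual to the Bott connection `∇_V N̄ = class of [V, N]` on `NF`:
`⟨∇*_V γ, N̄⟩ = V⟨γ, N̄⟩ - ⟨γ, ∇_V N̄⟩`. -/
def bottDual (V : F.sections) (γ : F.ConormalSection) (N : VField E C) : SmoothFn E C :=
  V.1.deriv (evalN γ N) - evalN γ (lie V.1 N)

/-- The differential `d_∇*` on `Ω⁰(F; N*F)`, `(d_∇* γ)(V) = ∇*_V γ`, through its values on fields. -/
def dNabla₀ : F.ConormalSection →ₗ[ℝ] (F.sections → VField E C → SmoothFn E C) where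
  toFun γ V N := bottDual V γ N
  map_add' γ γ' := by
    funext V N
    have h : ∀ X, evalN (γ + γ') X = evalN γ X + evalN γ' X := fun _ ↦ rfl
    simp only [bottDual, h, deriv_add, Pi.add_apply]
    abel
  map_smul' c γ := by
    funext V N
    have h : ∀ X, evalN (c • γ) X = c • evalN γ X := fun _ ↦ rfl
    simp only [bottDual, h, deriv_smul, Pi.smul_apply, RingHom.id_apply, smul_sub]

/-- The differential `d_∇*` on `Ω¹(F; N*F)`, through its values on fields:
`(d_∇* η)(V, W) = ∇*_V(η(W)) - ∇*_W(η(V)) - η([V, W])`. Note that the expression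
`⟨∇*_V(η(W)), N̄⟩` is `bottDual V (contract η W) N`. -/
def dNabla₁ : F.ConormalOneForm →ₗ[ℝ]
    (F.sections → F.sections → VField E C → SmoothFn E C) where
  toFun η V W N := bottDual V (contract η W) N - bottDual W (contract η V) N -
    evalN (contract η (lieΓ V W)) N
  map_add' η η' := by
    funext V W N
    have h : ∀ X Y, evalN (contract (η + η') X) Y = evalN (contract η X) Y + evalN (contract η' X) Y :=
      fun _ _ ↦ rfl
    simp only [bottDual, h, deriv_add, Pi.add_apply]
    abel
  map_smul' c η := by
    funext V W N
    have h : ∀ X Y, evalN (contract (c • η) X) Y = c • evalN (contract η X) Y := fun _ _ ↦ rfl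
    simp only [bottDual, h, deriv_smul, Pi.smul_apply, RingHom.id_apply, smul_sub]

/-- The `d_∇*`-closed elements of `Ω¹(F; N*F)`. -/
def ConormalCocycles : Submodule ℝ F.ConormalOneForm := LinearMap.ker F.dNabla₁

/-- The values `⟨η(V), N̄⟩` of an element of `Ω¹(F; N*F)`; they determine `η`. -/
def evalConormalOneForm : F.ConormalOneForm →ₗ[ℝ] (F.sections → VField E C → SmoothFn E C) where
  toFun η V N := evalN (contract η V) N
  map_add' _ _ := rfl
  map_smul' _ _ := rfl

/-- The `d_∇*`-exact elements of `Ω¹(F; N*F)`. -/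
def ConormalCoboundaries : Submodule ℝ F.ConormalOneForm :=
  (LinearMap.range F.dNabla₀).comap F.evalConormalOneForm

/-- The cohomology `H¹(F; N*F)`. -/
abbrev ConormalH1 : Type _ :=
  F.ConormalCocycles ⧸ F.ConormalCoboundaries.submoduleOf F.ConormalCocycles

/-- `Ω²_F(C)`: the 2-forms which vanish on pairs of vectors tangent to the foliation. -/
def RelTwoForm : Submodule ℝ (TwoForm E C) where
  carrier := {θ | ∀ x, ∀ v ∈ F.tangent x, ∀ w ∈ F.tangent x, θ.1 x v w = 0}
  add_mem' h h' x v hv w hw :=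
    (congrArg₂ (· + ·) (h x v hv w hw) (h' x v hv w hw)).trans (add_zero 0)
  zero_mem' _ _ _ _ _ := rfl
  smul_mem' c _ h x v hv w hw := (congrArg (c * ·) (h x v hv w hw)).trans (mul_zero c)

/-- The projection `p : Ω²_F(C) → Ω¹(F; N*F)`, `⟨p(θ)(V), N̄⟩ = θ(V, N)`. -/
def conormalProj : F.RelTwoForm →ₗ[ℝ] F.ConormalOneForm where
  toFun θ := ⟨fun x ↦
    { toFun v := (F.tangent x).liftQ (θ.1.1 x v) fun w hw ↦ θ.2 x v v.2 w hw
      map_add' v w := by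
        apply Submodule.linearMap_qext
        ext u
        exact congrArg (fun L ↦ L u) ((θ.1.1 x).map_add v.1 w.1)
      map_smul' c v := by
        apply Submodule.linearMap_qext
        ext u
        exact congrArg (fun L ↦ L u) ((θ.1.1 x).map_smul c v.1) }, fun V N ↦ (mem_twoForm.1 θ.1.2).2 V.1 N⟩
  map_add' θ θ' := Subtype.ext <| funext fun x ↦ LinearMap.ext fun v ↦
    Submodule.linearMap_qext _ (LinearMap.ext fun _ ↦ rfl)
  map_smul' c θ := Subtype.ext <| funext fun x ↦ LinearMap.ext fun v ↦
    Submodule.linearMap_qext _ (LinearMap.ext fun _ ↦ rfl)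

variable [T2Space C]

theorem exists_section {x : C} (v : TangentSpace 𝓘(ℝ, E) x) (hv : v ∈ F.tangent x) :
    ∃ V : F.sections, V.1 x = v := by
  obtain ⟨U, hU, hx, s, hs, hspan⟩ := F.exists_frame x
  have key : ∀ i, ∃ V : F.sections, V.1 x = s i x := fun i ↦ by
    obtain ⟨S, hS, hS'⟩ := exists_global hU hx (s i) (hs i)
    refine ⟨⟨S, fun y ↦ ?_⟩, hS.self_of_nhds⟩
    obtain ⟨c, hc, hc'⟩ := hS' y
    rw [hc]
    by_cases hy : y ∈ U
    · apply Submodule.smul_mem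
      rw [← (hspan y hy).2]
      exact Submodule.subset_span ⟨i, rfl⟩
    · simp [hc' hy]
  rw [← (hspan x hx).2] at hv
  induction hv using Submodule.span_induction with
  | mem v hv => obtain ⟨i, rfl⟩ := hv; exact key i
  | zero => exact ⟨0, rfl⟩
  | add v w _ _ h h' =>
    obtain ⟨V, rfl⟩ := h
    obtain ⟨W, rfl⟩ := h'
    exact ⟨V + W, rfl⟩
  | smul c v _ h => obtain ⟨V, rfl⟩ := h; exact ⟨c • V, rfl⟩

/-- The 1-forms whose restriction to `TF` is `d_F`-closed. -/
def closedExt : Submodule ℝ (OneForm E C) := F.Cocycles.comap F.restrict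

theorem extDerivOne_mem (a : OneForm E C) (ha : a ∈ F.closedExt) :
    extDerivOne a ∈ F.RelTwoForm := by
  intro x v hv w hw
  obtain ⟨V, rfl⟩ := F.exists_section v hv
  obtain ⟨W, rfl⟩ := F.exists_section w hw
  rw [extDerivOne_apply]
  exact DFunLike.congr_fun (congrFun (congrFun (LinearMap.mem_ker.1 ha) V) W) x

/-- The map `a ↦ p(da)`. -/
def conormalDeriv : F.closedExt →ₗ[ℝ] F.ConormalOneForm :=
  F.conormalProj ∘ₗ
    LinearMap.restrict (p := F.closedExt) (q := F.RelTwoForm) extDerivOne F.extDerivOne_mem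

theorem conormalDeriv_eval (a : F.closedExt) (V : F.sections) (N : VField E C) :
    evalN (contract (F.conormalDeriv a) V) N =
      V.1.deriv (a.1.eval N) - N.deriv (a.1.eval V.1) - a.1.eval (lie V.1 N) := by
  ext x
  exact extDerivOne_apply a.1 V.1 N x

theorem conormalDeriv_mem (a : F.closedExt) : F.conormalDeriv a ∈ F.ConormalCocycles := by
  refine LinearMap.mem_ker.2 (funext fun V ↦ funext fun W ↦ funext fun N ↦ ?_)
  have hVW : V.1.deriv (a.1.eval W.1) - W.1.deriv (a.1.eval V.1) - a.1.eval (lie V.1 W.1) = 0 :=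
    congrFun (congrFun (LinearMap.mem_ker.1 a.2) V) W
  have hN : N.deriv (V.1.deriv (a.1.eval W.1)) - N.deriv (W.1.deriv (a.1.eval V.1)) -
      N.deriv (a.1.eval (lie V.1 W.1)) = 0 := by
    rw [← deriv_sub, ← deriv_sub, hVW]
    simpa using deriv_smul N 0 0
  have hJ : a.1.eval (lie V.1 (lie W.1 N)) =
      a.1.eval (lie (lie V.1 W.1) N) + a.1.eval (lie W.1 (lie V.1 N)) := by
    ext x
    change a.1 x _ = a.1 x _ + a.1 x _
    rw [jacobi, ContMDiffSection.coe_add, Pi.add_apply, map_add]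
  change bottDual V (contract (F.conormalDeriv a) W) N - bottDual W (contract (F.conormalDeriv a) V) N -
    evalN (contract (F.conormalDeriv a) (lieΓ V W)) N = 0
  have hΓ : (lieΓ V W).1 = lie V.1 W.1 := rfl
  simp only [bottDual, conormalDeriv_eval, deriv_sub, hΓ, deriv_lie]
  rw [hJ]
  linear_combination (exp := 1) - hN

theorem conormalDeriv_mem_coboundaries (a : F.closedExt) (ha : F.restrict a.1 ∈ F.Coboundaries) :
    F.conormalDeriv a ∈ F.ConormalCoboundaries := by
  obtain ⟨f, hf⟩ := ha
  have hf' : ∀ x, ∀ v (hv : v ∈ F.tangent x), mvfderiv 𝓘(ℝ, E) f x v = a.1 x v := fun x v hv ↦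
    congrArg (fun β : F.FoliatedOneForm ↦ β.1 x ⟨v, hv⟩) hf
  let γ : F.ConormalSection := ⟨fun x ↦ (F.tangent x).liftQ
    ((a.1 x).toLinearMap - (mvfderiv 𝓘(ℝ, E) f x).toLinearMap)
    (fun v hv ↦ sub_eq_zero.2 (hf' x v hv).symm), fun N ↦ (a.1.eval N - N.deriv f).contMDiff⟩
  have hγ : ∀ N, evalN γ N = a.1.eval N - N.deriv f := fun N ↦ rfl
  have hV : ∀ V : F.sections, a.1.eval V.1 = V.1.deriv f := fun V ↦ by
    ext x; exact (hf' x _ (V.2 x)).symm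
  refine ⟨γ, funext fun V ↦ funext fun N ↦ ?_⟩
  change bottDual V γ N = evalN (contract (F.conormalDeriv a) V) N
  rw [conormalDeriv_eval, bottDual, hγ, hγ, hV, deriv_sub, deriv_lie]
  abel

theorem exists_local_ext (β : F.FoliatedOneForm) (x₀ : C) : ∃ U ∈ 𝓝 x₀,
    ∃ s : ∀ x : C, TangentSpace 𝓘(ℝ, E) x →L[ℝ] ℝ,
      ContMDiffOn 𝓘(ℝ, E) (𝓘(ℝ, E).prod 𝓘(ℝ, E →L[ℝ] ℝ)) ∞
        (fun x ↦ TotalSpace.mk' (E →L[ℝ] ℝ)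
          (E := fun x : C ↦ TangentSpace 𝓘(ℝ, E) x →L[ℝ] ℝ) x (s x)) U ∧
      ∀ y ∈ U, ∀ v : F.tangent y, s y v.1 = β.1 y v := by
  have : CompleteSpace E := FiniteDimensional.complete ℝ E
  obtain ⟨U, hU, hx, s, hs, hspan⟩ := F.exists_frame x₀
  have key : ∀ i, ∃ V : F.sections, ∀ᶠ x in 𝓝 x₀, V.1 x = s i x := fun i ↦ by
    obtain ⟨S, hS, hS'⟩ := exists_global hU hx (s i) (hs i)
    refine ⟨⟨S, fun y ↦ ?_⟩, hS⟩
    obtain ⟨c, hc, hc'⟩ := hS' y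
    rw [hc]
    by_cases hy : y ∈ U
    · apply Submodule.smul_mem
      rw [← (hspan y hy).2]
      exact Submodule.subset_span ⟨i, rfl⟩
    · simp [hc' hy]
  choose V hV using key
  let e := trivializationAt E (TangentSpace 𝓘(ℝ, E) : C → Type _) x₀
  have hxe : x₀ ∈ e.baseSet := FiberBundle.mem_baseSet_trivializationAt E _ x₀
  let u : Fin F.rank → C → E := fun i y ↦ (e ⟨y, (V i).1 y⟩).2
  have hu : ∀ i, ContMDiffOn 𝓘(ℝ, E) 𝓘(ℝ, E) ∞ (u i) e.baseSet := fun i ↦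
    e.contMDiffOn_section_baseSet_iff.1 (V i).1.contMDiff.contMDiffOn
  have hli : LinearIndependent ℝ fun i ↦ u i x₀ := by
    have h1 := (hspan x₀ hx).1
    have h2 : (fun i ↦ u i x₀) = fun i ↦ e.continuousLinearEquivAt ℝ x₀ hxe (s i x₀) := by
      ext i; rw [← (hV i).self_of_nhds]; rfl
    rw [h2]
    exact h1.map' (e.continuousLinearEquivAt ℝ x₀ hxe).toLinearEquiv.toLinearMap
      (LinearEquiv.ker _)
  obtain ⟨ℓ, hℓ⟩ : ∃ ℓ : Fin F.rank → (E →L[ℝ] ℝ), ∀ i j, ℓ i (u j x₀) = if i = j then 1 else 0 := by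
    have h (i : Fin F.rank) := LinearMap.exists_extend (Finsupp.lapply i ∘ₗ hli.repr)
    choose g hg using h
    refine ⟨fun i ↦ LinearMap.toContinuousLinearMap (g i), fun i j ↦ ?_⟩
    have hm : u j x₀ ∈ Submodule.span ℝ (Set.range fun i ↦ u i x₀) := Submodule.subset_span ⟨j, rfl⟩
    have h1 := LinearMap.congr_fun (hg i) ⟨u j x₀, hm⟩
    have h2 := hli.repr_eq_single j ⟨u j x₀, hm⟩ rfl
    simp only [LinearMap.comp_apply, h2, Submodule.subtype_apply, Finsupp.lapply_apply,
      Finsupp.single_apply] at h1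
    rw [LinearMap.coe_toContinuousLinearMap', h1]
    simp only [eq_comm]
  let D : C → (E →L[ℝ] E) := fun y ↦
    ContinuousLinearMap.id ℝ E + ∑ i, (ℓ i).smulRight (u i y - u i x₀)
  have hD : ∀ y j, D y (u j x₀) = u j y := fun y j ↦ by
    simp [D, hℓ]
  have hDx : D x₀ = ContinuousLinearMap.id ℝ E := by simp [D]
  have hDs : ContMDiffOn 𝓘(ℝ, E) 𝓘(ℝ, E →L[ℝ] E) ∞ D e.baseSet := by
    refine contMDiffOn_const.add (contMDiffOn_finsetSum fun i _ ↦ ?_)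
    have h1 : ContMDiff 𝓘(ℝ, E) 𝓘(ℝ, E →L[ℝ] E) ∞ (ContinuousLinearMap.smulRightL ℝ E E (ℓ i)) :=
      (ContinuousLinearMap.contDiff _).contMDiff
    exact h1.comp_contMDiffOn ((hu i).sub contMDiffOn_const)
  have hDc : ContinuousAt D x₀ :=
    (hDs.contMDiffAt (e.open_baseSet.mem_nhds hxe)).continuousAt
  have hDi : ∀ᶠ y in 𝓝 x₀, D y ∈ Set.range ((↑) : (E ≃L[ℝ] E) → E →L[ℝ] E) := by
    refine hDc.eventually (ContinuousLinearEquiv.isOpen.mem_nhds ?_)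
    rw [hDx]
    exact ⟨ContinuousLinearEquiv.refl ℝ E, rfl⟩
  let Λ : C → (E →L[ℝ] ℝ) := fun y ↦ (∑ i, evalF β (V i) y • ℓ i) ∘L (D y).inverse
  refine ⟨_, Filter.inter_mem (Filter.inter_mem (hU.mem_nhds hx) (e.open_baseSet.mem_nhds hxe))
    (Filter.inter_mem (Filter.eventually_all.2 hV) hDi),
    fun y ↦ Λ y ∘L e.continuousLinearMapAt ℝ y, ?_, ?_⟩
  · rintro y ⟨⟨hyU, hye⟩, -, ⟨G, hG⟩⟩
    apply ContMDiffAt.contMDiffWithinAt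
    have hΛ : ContMDiffAt 𝓘(ℝ, E) 𝓘(ℝ, E →L[ℝ] ℝ) ∞ Λ y := by
      have h1 : ContMDiffAt 𝓘(ℝ, E) 𝓘(ℝ, E →L[ℝ] ℝ) ∞ (fun y ↦ ∑ i, evalF β (V i) y • ℓ i) y :=
        contMDiffAt_finsetSum fun i _ ↦ (evalF β (V i)).contMDiff.contMDiffAt.smul contMDiffAt_const
      have h2 : ContMDiffAt 𝓘(ℝ, E) 𝓘(ℝ, E →L[ℝ] E) ∞ (fun y ↦ (D y).inverse) y := by
        have h3 := contDiffAt_map_inverse (𝕜 := ℝ) (n := ∞) G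
        rw [hG] at h3
        exact h3.contMDiffAt.comp y (hDs.contMDiffAt (e.open_baseSet.mem_nhds hye))
      exact h1.clm_comp h2
    rw [(trivializationAt (E →L[ℝ] ℝ) (fun x : C ↦ TangentSpace 𝓘(ℝ, E) x →L[ℝ] ℝ)
      x₀).contMDiffAt_section_iff (by exact ⟨hye, Set.mem_univ _⟩)]
    refine hΛ.congr_of_eventuallyEq ?_
    filter_upwards [e.open_baseSet.mem_nhds hye] with z hz
    rw [hom_trivializationAt_apply]
    ext v
    simp only [ContinuousLinearMap.inCoordinates]
    have h4 := e.continuousLinearMapAt_symmL (R := ℝ) hz v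
    change (trivializationAt ℝ (Bundle.Trivial C ℝ) x₀).continuousLinearMapAt ℝ z
      (Λ z (e.continuousLinearMapAt ℝ z (e.symmL ℝ z v))) = Λ z v
    rw [h4]
    exact DFunLike.congr_fun
      (Bundle.Trivial.continuousLinearMapAt_trivialization ℝ C ℝ z) (Λ z v)
  · rintro y ⟨⟨hyU, hye⟩, hyV, ⟨G, hG⟩⟩ ⟨v, hv⟩
    have hyV' : ∀ i, (V i).1 y = s i y := hyV
    have hbase : ∀ i, Λ y (e.continuousLinearMapAt ℝ y (s i y)) = evalF β (V i) y := fun i ↦ by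
      have h1 : e.continuousLinearMapAt ℝ y (s i y) = u i y := by
        rw [← hyV' i]
        exact e.continuousLinearMapAt_apply_of_mem ℝ hye _
      have h2 : (D y).inverse (u i y) = u i x₀ := by
        rw [← hD y i, ← hG, ContinuousLinearMap.inverse_equiv]
        exact G.symm_apply_apply _
      simp only [Λ, ContinuousLinearMap.comp_apply, h1, h2]
      simp [hℓ]
    change Λ y (e.continuousLinearMapAt ℝ y v) = β.1 y ⟨v, hv⟩
    let L₁ : TangentSpace 𝓘(ℝ, E) y →ₗ[ℝ] ℝ := (Λ y ∘L e.continuousLinearMapAt ℝ y).toLinearMap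
    have hLe : L₁ ∘ₗ (F.tangent y).subtype = β.1 y := by
      have hmem : ∀ i, s i y ∈ F.tangent y := fun i ↦ by
        rw [← (hspan y hyU).2]; exact Submodule.subset_span ⟨i, rfl⟩
      have hspan' : ∀ w, w ∈ Submodule.span ℝ (Set.range fun i ↦ s i y) →
          ∀ hw : w ∈ F.tangent y, L₁ w = β.1 y ⟨w, hw⟩ := fun w hw ↦ by
        induction hw using Submodule.span_induction with
        | mem w hw =>
          obtain ⟨i, rfl⟩ := hw
          intro hw
          refine (hbase i).trans ?_
          exact congrArg (β.1 y) (Subtype.ext (hyV' i))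
        | zero => intro hw; rw [map_zero]; exact ((β.1 y).map_zero).symm
        | add w w' hw hw' h h' =>
          intro hww
          have m : w ∈ F.tangent y := by rw [← (hspan y hyU).2]; exact hw
          have m' : w' ∈ F.tangent y := by rw [← (hspan y hyU).2]; exact hw'
          rw [map_add, h m, h' m', ← map_add]; rfl
        | smul c w hw h =>
          intro hww
          have m : w ∈ F.tangent y := by rw [← (hspan y hyU).2]; exact hw
          rw [map_smul, h m, ← map_smul]; rfl
      ext ⟨w, hw⟩
      exact hspan' w (by rw [(hspan y hyU).2]; exact hw) hw
    exact LinearMap.congr_fun hLe ⟨v, hv⟩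

theorem exists_ext [SecondCountableTopology C] (β : F.FoliatedOneForm) : ∃ a : OneForm E C, F.restrict a = β := by
  have : LocallyCompactSpace C := Manifold.locallyCompact_of_finiteDimensional 𝓘(ℝ, E)
  obtain ⟨a, ha⟩ := exists_contMDiffSection_forall_mem_convex_of_local (n := ⊤) 𝓘(ℝ, E)
    (F_fiber := E →L[ℝ] ℝ) (fun x : C ↦ TangentSpace 𝓘(ℝ, E) x →L[ℝ] ℝ)
    (fun x ↦ {l | ∀ v : F.tangent x, l v.1 = β.1 x v})
    (fun x l hl l' hl' c d hc hd hcd v ↦ by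
      change c * l v.1 + d * l' v.1 = _
      rw [hl v, hl' v, ← add_mul, hcd, one_mul])
    (F.exists_local_ext β)
  exact ⟨a, Subtype.ext <| funext fun x ↦ LinearMap.ext fun v ↦ ha x v⟩

variable [SecondCountableTopology C]

/-- Restriction to `TF`, from 1-forms with closed restriction to closed foliated 1-forms. -/
def closedRestrict : F.closedExt →ₗ[ℝ] F.Cocycles :=
  LinearMap.restrict F.restrict fun _ h ↦ h

theorem closedRestrict_surjective : Function.Surjective F.closedRestrict := fun β ↦ by
  obtain ⟨a, ha⟩ := F.exists_ext β.1
  exact ⟨⟨a, by change F.restrict a ∈ F.Cocycles; rw [ha]; exact β.2⟩, Subtype.ext ha⟩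

/-- The map `a ↦ [p(da)]` into `H¹(F; N*F)`. -/
def toConormalH1 : F.closedExt →ₗ[ℝ] F.ConormalH1 :=
  (F.ConormalCoboundaries.submoduleOf F.ConormalCocycles).mkQ ∘ₗ
    F.conormalDeriv.codRestrict F.ConormalCocycles F.conormalDeriv_mem

/-- The map `a ↦ [a|_TF]` into `H¹(F)`. -/
def toH1 : F.closedExt →ₗ[ℝ] F.H1 :=
  (F.Coboundaries.submoduleOf F.Cocycles).mkQ ∘ₗ F.closedRestrict

theorem toH1_surjective : Function.Surjective F.toH1 :=
  (Submodule.mkQ_surjective _).comp F.closedRestrict_surjective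

theorem ker_toH1_le : LinearMap.ker F.toH1 ≤ LinearMap.ker F.toConormalH1 := fun a ha ↦ by
  rw [LinearMap.mem_ker] at ha ⊢
  have h1 := (Submodule.Quotient.mk_eq_zero _).1 ha
  exact (Submodule.Quotient.mk_eq_zero _).2 (F.conormalDeriv_mem_coboundaries a h1)

/-- The transverse differentiation map `d_ν : H¹(F) → H¹(F; N*F)`, `[α] ↦ [p(dα̃)]`, where `α̃` is any
extension of `α` to a 1-form on `C` (see `dν_apply`). It is obtained from `a ↦ [p(da)]` by factoring
through the surjection `a ↦ [a|_TF]`. -/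
def dν : F.H1 →ₗ[ℝ] F.ConormalH1 :=
  (LinearMap.ker F.toH1).liftQ F.toConormalH1 F.ker_toH1_le ∘ₗ
    (F.toH1.quotKerEquivOfSurjective F.toH1_surjective).symm

theorem dν_apply (a : F.closedExt) : F.dν (F.toH1 a) = F.toConormalH1 a := by
  have : (F.toH1.quotKerEquivOfSurjective F.toH1_surjective).symm (F.toH1 a) =
      (LinearMap.ker F.toH1).mkQ a := by
    rw [LinearEquiv.symm_apply_eq]; rfl
  change (LinearMap.ker F.toH1).liftQ F.toConormalH1 F.ker_toH1_le
    ((F.toH1.quotKerEquivOfSurjective F.toH1_surjective).symm (F.toH1 a)) = _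
  rw [this]; rfl

/-- A 2-form `θ` is basic if `ι_V θ = 0` and `£_V θ = 0` for all `V` in `Γ(TF)`. -/
def IsBasic (θ : TwoForm E C) : Prop :=
  ∀ V : F.sections, interior V.1 θ = 0 ∧ lieDeriv V.1 θ = 0

end Foliation
end Fol
end Foliated

end

noncomputable section
namespace Foliated

/-! ### Cartan calculus for the exterior derivative of a 1-form -/

variable {E : Type*} [NormedAddCommGroup E] [NormedSpace ℝ E] [FiniteDimensional ℝ E]
  {C : Type*} [TopologicalSpace C] [ChartedSpace E C] [IsManifold 𝓘(ℝ, E) ∞ C]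

/-! Let `a` extend `β`. For `V` tangent to the foliation, `da(V, N)` carries both conditions: on
tangent `N` it is the foliated differential of `β`, and once that vanishes, what remains is `p(da)`,
a function of `V` and the class of `N`. So `ι_V da = 0` for all tangent `V` says exactly that `β` is
closed and `p(da) = 0` as a form. The vanishing of `d_ν[β]` says only that `p(da)` is exact, `p(da)
= d_∇* γ`, and the task is to choose a better extension.

The correction is `γ` itself. Pulled back along `TC → NF` it is a 1-form `c` that vanishes on `TF`,
so `a - c` still extends `β`. As `c(V) = 0`, the Koszul formula reduces to `dc(V, N) = V(c(N)) -
c([V, N])`, which is the dual Bott connection: `p(dc) = d_∇* γ`. Hence `ι_V d(a - c) = 0`; this is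
`exists_interior_eq_zero`. Conversely, if `ι_V da = 0`, then `p(da)` is zero and so is its class.

For the statement on basic forms only `£_V da = 0` needs proof. It follows from `ι_V da = 0` by the
Jacobi identity, which here replaces Cartan's formula and `d ∘ d = 0`
(`lieDeriv_extDerivOne_eq_zero`).

The one analytic point is that the pullback of `γ` is a smooth section of the cotangent bundle,
whereas `γ` is known to be smooth only through its values on vector fields. `exists_oneForm`
supplies this by applying the extension theorem `exists_ext` to the foliation with tangent
distribution `TC`. -/

theorem evalTwo_extDerivOne [T2Space C] (a : OneForm E C) (X Y : VField E C) :
    evalTwo (extDerivOne a) X Y = X.deriv (a.eval Y) - Y.deriv (a.eval X) - a.eval (lie X Y) := by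
  ext x
  exact extDerivOne_apply a X Y x

/-- Every tangent vector is the value of a global smooth field, so a pointwise condition on `da` can
be tested on fields, where the Koszul formula applies. -/
theorem interior_extDerivOne_eq_zero_iff [T2Space C] (a : OneForm E C) (V : VField E C) :
    interior V (extDerivOne a) = 0 ↔
      ∀ N : VField E C, V.deriv (a.eval N) - N.deriv (a.eval V) - a.eval (lie V N) = 0 := by
  constructor
  · intro h N
    ext x
    rw [← extDerivOne_apply]
    exact LinearMap.congr_fun (congrFun h x) (N x)
  · intro h
    funext x
    ext v
    obtain ⟨N, rfl⟩ := exists_vfield (E := E) x v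
    exact (extDerivOne_apply a V N x).trans (DFunLike.congr_fun (h N) x)

theorem OneForm.eval_jacobi (a : OneForm E C) (U V W : VField E C) :
    a.eval (lie U (lie V W)) = a.eval (lie (lie U V) W) + a.eval (lie V (lie U W)) := by
  ext x
  change a x _ = a x _ + a x _
  rw [jacobi, ContMDiffSection.coe_add, Pi.add_apply, map_add]

/-- If `ι_V da = 0` then `£_V da = 0`, since `£_V da = d (ι_V da)`. -/
theorem lieDeriv_extDerivOne_eq_zero [T2Space C] {a : OneForm E C} {V : VField E C}
    (h : interior V (extDerivOne a) = 0) : lieDeriv V (extDerivOne a) = 0 := by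
  rw [interior_extDerivOne_eq_zero_iff] at h
  have hV : ∀ N, a.eval (lie V N) = V.deriv (a.eval N) - N.deriv (a.eval V) := fun N ↦
    (sub_eq_zero.1 (h N)).symm
  funext X Y
  have hJ := a.eval_jacobi V X Y
  -- The Lie derivative contains `a([[V, X], Y])` and `a([X, [V, Y]])`, which `hV` cannot rewrite.
  -- Jacobi gives their sum as `a([V, [X, Y]])`, to which `hV` does apply.
  rw [hV (lie X Y), deriv_lie] at hJ
  simp only [lieDeriv, evalTwo_extDerivOne, deriv_sub, hV, deriv_lie, Pi.zero_apply]
  linear_combination (exp := 1) -hJ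

/-! ### Smoothness of 1-forms tested on vector fields -/

variable (E C) in
/-- The foliation whose leaves are open: its tangent distribution is all of `TC`. -/
def Foliation.top : Foliation E C where
  rank := Module.finrank ℝ E
  tangent _ := ⊤
  exists_frame x₀ := by
    let e := trivializationAt E (TangentSpace 𝓘(ℝ, E) : C → Type _) x₀
    let b := Module.finBasis ℝ E
    refine ⟨e.baseSet, e.open_baseSet, FiberBundle.mem_baseSet_trivializationAt E _ x₀,
      fun i x ↦ e.symm x (b i), fun i ↦ ?_, fun x hx ↦ ?_⟩
    · rw [e.contMDiffOn_section_baseSet_iff]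
      refine (contMDiffOn_const (c := b i)).congr fun x hx ↦ ?_
      rw [e.apply_mk_symm hx]
    · let b' := b.map (e.continuousLinearEquivAt ℝ x hx).symm.toLinearEquiv
      have hb : (fun i ↦ e.symm x (b i)) = b' := by
        funext i
        simp only [b', Module.Basis.map_apply]
        rfl
      rw [hb]
      exact ⟨b'.linearIndependent, b'.span_eq⟩
  involutive _ _ _ _ _ := trivial

/-- A family of linear forms which takes smooth fields to smooth functions is a smooth 1-form. -/
theorem exists_oneForm [T2Space C] [SecondCountableTopology C]
    (l : ∀ x : C, TangentSpace 𝓘(ℝ, E) x →ₗ[ℝ] ℝ)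
    (hl : ∀ V : VField E C, ContMDiff 𝓘(ℝ, E) 𝓘(ℝ, ℝ) ∞ fun x ↦ l x (V x)) :
    ∃ a : OneForm E C, ∀ x v, a x v = l x v := by
  -- With tangent distribution `TC` there is nothing to extend pointwise; what `exists_ext`
  -- contributes is that the result is a smooth section of the cotangent bundle.
  obtain ⟨a, ha⟩ := (Foliation.top E C).exists_ext
    ⟨fun x ↦ l x ∘ₗ Submodule.subtype _, fun V ↦ hl V.1⟩
  exact ⟨a, fun x v ↦ congrArg
    (fun β : (Foliation.top E C).FoliatedOneForm ↦ β.1 x ⟨v, trivial⟩) ha⟩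

/-! ### Exactness of `p(da)` and the choice of extension -/

namespace Foliation
variable [T2Space C] (F : Foliation E C)

/-- On two sections of `TF` the Koszul expression for `da` is the foliated differential of the
restriction of `a`. -/
theorem mem_closedExt_of_interior_eq_zero {a : OneForm E C}
    (h : ∀ V : F.sections, interior V.1 (extDerivOne a) = 0) : a ∈ F.closedExt :=
  LinearMap.mem_ker.2 <| funext fun V ↦ funext fun W ↦
    (interior_extDerivOne_eq_zero_iff a V.1).1 (h V) W.1

/-- Here `p(da)` vanishes as a form, so the zero section is a primitive. -/
theorem conormalDeriv_mem_coboundaries_of_interior_eq_zero (a : F.closedExt)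
    (h : ∀ V : F.sections, interior V.1 (extDerivOne a.1) = 0) :
    F.conormalDeriv a ∈ F.ConormalCoboundaries := by
  refine ⟨0, (map_zero _).trans (funext fun V ↦ funext fun N ↦ ?_)⟩
  exact ((F.conormalDeriv_eval a V N).trans
    ((interior_extDerivOne_eq_zero_iff a.1 V.1).1 (h V) N)).symm

theorem toConormalH1_eq_zero_iff (a : F.closedExt) :
    F.toConormalH1 a = 0 ↔ F.conormalDeriv a ∈ F.ConormalCoboundaries :=
  Submodule.Quotient.mk_eq_zero _

variable [SecondCountableTopology C]

/-- Pullback of a section of `N*F` to a 1-form on `C` vanishing on `TF`. -/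
theorem exists_oneForm_of_conormalSection (γ : F.ConormalSection) :
    ∃ c : OneForm E C, F.restrict c = 0 ∧ ∀ N, c.eval N = evalN γ N := by
  obtain ⟨c, hc⟩ := exists_oneForm (fun x ↦ γ.1 x ∘ₗ (F.tangent x).mkQ) γ.2
  refine ⟨c, Subtype.ext <| funext fun x ↦ LinearMap.ext fun v ↦ ?_, fun N ↦ ?_⟩
  · refine (hc x v.1).trans ?_
    change γ.1 x ((F.tangent x).mkQ v.1) = 0
    rw [Submodule.mkQ_apply, (Submodule.Quotient.mk_eq_zero _).2 v.2, map_zero]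
  · ext x
    exact hc x (N x)

/-- Subtract from `a` the pullback of a primitive of `p(da)`. The pullback vanishes on `TF`, so the
restriction does not change, and its exterior derivative contributes exactly `d_∇* γ`. -/
theorem exists_interior_eq_zero (a : F.closedExt) (h : F.conormalDeriv a ∈ F.ConormalCoboundaries) :
    ∃ b : OneForm E C, F.restrict b = F.restrict a.1 ∧
      ∀ V : F.sections, interior V.1 (extDerivOne b) = 0 := by
  obtain ⟨γ, hγ⟩ := h
  obtain ⟨c, hc, hcN⟩ := F.exists_oneForm_of_conormalSection γ
  refine ⟨a.1 - c, by rw [map_sub, hc, sub_zero], fun V ↦ ?_⟩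
  rw [interior_extDerivOne_eq_zero_iff]
  intro N
  -- This removes the term `N(c(V))` from `dc(V, N)`, leaving the Bott expression.
  have hcV : c.eval V.1 = 0 := by
    ext x
    exact congrArg (fun β : F.FoliatedOneForm ↦ β.1 x ⟨V.1 x, V.2 x⟩) hc
  have hN : N.deriv (0 : SmoothFn E C) = 0 := by simpa using deriv_smul N 0 0
  have hd : V.1.deriv (evalN γ N) - evalN γ (lie V.1 N) =
      V.1.deriv (a.1.eval N) - N.deriv (a.1.eval V.1) - a.1.eval (lie V.1 N) :=
    (congrFun (congrFun hγ V) N).trans (F.conormalDeriv_eval a V N)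
  have hs : ∀ X, (a.1 - c).eval X = a.1.eval X - c.eval X := fun _ ↦ rfl
  simp only [hs, deriv_sub, hcV, hN, hcN]
  linear_combination (exp := 1) -hd

end Foliation
end Foliated

end

/-! ### The equivalence and the basic form statement -/

theorem mainTheorem6 {E : Type*} [NormedAddCommGroup E] [NormedSpace ℝ E] [FiniteDimensional ℝ E]
    {C : Type*} [TopologicalSpace C] [ChartedSpace E C] [IsManifold 𝓘(ℝ, E) ∞ C]
    [T2Space C] [SecondCountableTopology C]
    (F : Foliated.Foliation E C) (β : F.FoliatedOneForm) :
    ((∃ h : F.dF₁ β = 0, F.dν (F.cohomologyClass β h) = 0) ↔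
      ∃ a : Foliated.OneForm E C, F.restrict a = β ∧
        ∀ V : F.sections, Foliated.interior V.1 (Foliated.extDerivOne a) = 0) ∧
    ∀ a : Foliated.OneForm E C,
      (∀ V : F.sections, Foliated.interior V.1 (Foliated.extDerivOne a) = 0) ↔
        F.IsBasic (Foliated.extDerivOne a) := by
  refine ⟨⟨fun ⟨h, hβ⟩ ↦ ?_, fun ⟨a, hβ, ha⟩ ↦ ?_⟩, fun a ↦
    ⟨fun h V ↦ ⟨h V, Foliated.lieDeriv_extDerivOne_eq_zero (h V)⟩, fun h V ↦ (h V).1⟩⟩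
  -- Any extension serves as a start. With `β` replaced by its restriction, `h` is the membership of
  -- `a` in `closedExt`.
  · obtain ⟨a, rfl⟩ := F.exists_ext β
    refine F.exists_interior_eq_zero ⟨a, h⟩ ((F.toConormalH1_eq_zero_iff ⟨a, h⟩).1 ?_)
    rwa [← F.dν_apply]
  · subst hβ
    have h := F.mem_closedExt_of_interior_eq_zero ha
    refine ⟨h, ?_⟩
    -- The class of the restriction of `a` is by definition `toH1` of `a`, so `d_ν` can be computed
    -- with this very extension.
    change F.dν (F.toH1 ⟨a, h⟩) = 0
    rw [F.dν_apply, F.toConormalH1_eq_zero_iff]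
    exact F.conormalDeriv_mem_coboundaries_of_interior_eq_zero ⟨a, h⟩ ha
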